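/- **Lemma 2.6.** Let $(S,\Sigma_S,\nu)$ and $(T,\Sigma_T,\mu)$ be arbitrary positive measure spaces and let $X$, $Y$ be complex Banach spaces. Let $$\varepsilon(S,X)=\Big\{\sum_{i=1}^n x_i 1_{A_i} : n\in\mathbb N,\ x_i\in X,\ A_i\in\Sigma_S,\ \nu(A_i)<\infty\Big\}.$$ Let $1\le\theta<\infty$, let $\theta'\in(1,\infty]$ be given by $\frac1\theta+\frac1{\theta'}=1$, and let $1\le q<\theta'$ and $1\le p<\infty$ satisfy $\frac1q-\frac1p=1-\frac1\theta$. Let $C_1,C_2\ge 0$ and suppose that a linear operator $K:\varepsilon(S,X)\to L_\theta(T,Y)+L_\infty(T,Y)$ satisfies, for all $f\in\varepsilon(S,X)$, $$\|Kf\|_{L_\theta(T,Y)}\le C_1\|f\|_{L_1(S,X)}\quad\text{and}\quad \|Kf\|_{L_\infty(T,Y)}\le C_2\|f\|_{L_{\theta'}(S,X)}.$$ Then $K$ extends to a bounded linear operator $K:L_q(S,X)\to L_p(T,Y)$ with $$\|K\|_{L_q\to L_p}\le C_1^{\theta/p}\,C_2^{1-\theta/p},$$ where $0^0=1$. -/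

import Mathlib

open MeasureTheory
open scoped NNReal ENNReal

/-- The space `ε(S, X)` of finitely valued, finitely supported measurable functions `S → X`:
all finite sums `∑ i, x i • 1_{A i}` with `x i ∈ X` and `A i` measurable of finite measure.
Its elements are genuine functions, not classes modulo null sets. -/
def finSimple {S : Type*} [MeasurableSpace S] (ν : Measure S)
    (X : Type*) [NormedAddCommGroup X] [NormedSpace ℂ X] : Submodule ℂ (S → X) where
  carrier := {f | ∃ (n : ℕ) (x : Fin n → X) (A : Fin n → Set S),
    (∀ i, MeasurableSet (A i) ∧ ν (A i) < ∞) ∧ f = ∑ i, (A i).indicator fun _ => x i}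
  zero_mem' := ⟨0, Fin.elim0, Fin.elim0, fun i => i.elim0, by simp⟩
  add_mem' := by
    rintro f g ⟨m, x, A, hA, rfl⟩ ⟨n, y, B, hB, rfl⟩
    refine ⟨m + n, Fin.append x y, Fin.append A B, fun i => ?_, ?_⟩
    · refine Fin.addCases (fun j => ?_) (fun j => ?_) i
      · simpa using hA j
      · simpa using hB j
    · simp [Fin.sum_univ_add]
  smul_mem' := by
    rintro c f ⟨n, x, A, hA, rfl⟩
    refine ⟨n, fun i => c • x i, A, hA, ?_⟩
    rw [Finset.smul_sum]
    refine Finset.sum_congr rfl fun i _ => ?_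
    ext s
    by_cases hs : s ∈ A i <;> simp [hs]

/-- Every element of `ε(S, X)` lies in every `L_r(S, X)`. -/
theorem finSimple_memLp {S : Type*} [MeasurableSpace S] {ν : Measure S}
    {X : Type*} [NormedAddCommGroup X] [NormedSpace ℂ X] (f : finSimple ν X) (r : ℝ≥0∞) :
    MemLp (f : S → X) r ν := by
  obtain ⟨f, n, x, A, hA, rfl⟩ := f
  change MemLp (∑ i, (A i).indicator fun _ => x i) r ν
  exact memLp_finsetSum' _ fun i _ =>
    memLp_indicator_const r (hA i).1 (x i) (Or.inr (hA i).2.ne)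

/-- The sum space `L_r(T, Y) + L_∞(T, Y)`, inside the space of all classes modulo
`μ`-almost everywhere equality of a.e. strongly measurable functions `T → Y`. -/
noncomputable def LpAddLinfty {T : Type*} [MeasurableSpace T] (μ : Measure T)
    (Y : Type*) [NormedAddCommGroup Y] [NormedSpace ℂ Y] (r : ℝ≥0∞) :
    Submodule ℂ (T →ₘ[μ] Y) :=
  Lp.LpSubmodule ℂ Y r μ ⊔ Lp.LpSubmodule ℂ Y ∞ μ

/-! Write a step function as `f = ∑ a i • u i 1_{A i}` with disjoint `A i`, unit vectors `u i` and
`a i ≥ 0`, and put `w i = ν (A i)`, `h i = K (u i 1_{A i}) / w i`. The first bound says `‖h i‖_θ ≤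
C₁`. The second, applied to all coefficient vectors at almost every `t` at once
(`ae_forall_norm_sum_smul_le`), says by duality that `∑ w i |y (h i t)| ^ θ ≤ C₂ ^ θ` for every
functional `y` of norm at most one. Taking `y` norming for `K f t`, Hölder with exponents `1/p`, `1
- 1/θ`, `1/θ - 1/p` bounds `‖K f t‖` by `(∑ w i a i ^ q ‖h i t‖ ^ θ) ^ (1/p)` times a constant
(`nnnorm_sum_smul_le`). The functional depends on `t` but is gone from this bound, so no measurable
choice is needed. Integrating the `p`-th power gives the estimate with the sharp constant, and
density of step functions in `L_q` finishes. -/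

/-! ### Finite Hölder inequalities and the pointwise estimate -/

/-- Hölder's inequality for three families, allowing vanishing exponents. -/
theorem NNReal.sum_rpow_mul_rpow_mul_rpow_le {ι : Type*} [Fintype ι] (f g h : ι → ℝ≥0)
    {α β γ : ℝ} (hα : 0 ≤ α) (hβ : 0 ≤ β) (hγ : 0 ≤ γ) (hsum : α + β + γ = 1) :
    ∑ i, f i ^ α * g i ^ β * h i ^ γ ≤
      (∑ i, f i) ^ α * (∑ i, g i) ^ β * (∑ i, h i) ^ γ := by
  let _ : MeasurableSpace ι := ⊤
  have key := ENNReal.lintegral_prod_norm_pow_le (μ := (Measure.count : Measure ι))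
    (Finset.univ : Finset (Fin 3))
    (f := ![fun i => (f i : ℝ≥0∞), fun i => (g i : ℝ≥0∞), fun i => (h i : ℝ≥0∞)])
    (fun i _ => (measurable_of_countable _).aemeasurable)
    (p := ![α, β, γ]) (by simpa [Fin.sum_univ_three] using hsum)
    (by intro i _; fin_cases i <;> simpa)
  simp only [lintegral_count, tsum_fintype, Fin.prod_univ_three] at key
  simp only [Matrix.cons_val_zero, Matrix.cons_val_one, Matrix.cons_val] at key
  simp only [← ENNReal.coe_rpow_of_nonneg _ hα, ← ENNReal.coe_rpow_of_nonneg _ hβ,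
    ← ENNReal.coe_rpow_of_nonneg _ hγ, ← ENNReal.coe_mul, ← ENNReal.ofNNReal_finsetSum] at key
  exact ENNReal.coe_le_coe.mp key

/-- The converse of Hölder's inequality, for a finite family of complex numbers. -/
theorem sum_mul_rpow_le_of_forall_norm_sum_le {ι : Type*} [Fintype ι] (w : ι → ℝ≥0) (z : ι → ℂ)
    {θ : ℝ} (hθ : 1 ≤ θ) (C : ℝ≥0)
    (H : ∀ (b : ι → ℂ), (∀ i, ‖b i‖₊ ≤ ‖z i‖₊ ^ (θ - 1)) →
      ‖∑ i, ((w i : ℂ) * b i) * z i‖₊ ≤ C * (∑ i, w i * ‖z i‖₊ ^ θ) ^ (1 - 1 / θ)) :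
    ∑ i, w i * ‖z i‖₊ ^ θ ≤ C ^ θ := by
  have hθ0 : 0 < θ := by linarith
  set W := ∑ i, w i * ‖z i‖₊ ^ θ with hW
  rcases eq_or_ne W 0 with h0 | h0
  · rw [h0]; exact zero_le
  -- The extremal case of Hölder: `b i * z i = ‖z i‖ ^ θ`. Where `z i = 0`, division by zero makes
  -- `b i = 0`, which is admissible even for `θ = 1`.
  have h1 := H (fun i => starRingEnd ℂ (z i) / (‖z i‖ : ℂ) * ((‖z i‖₊ ^ (θ - 1) : ℝ≥0) : ℂ)) (by
    intro i
    rcases eq_or_ne (z i) 0 with hz | hz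
    · simp [hz]
    · have : ‖z i‖₊ ≠ 0 := by simpa using hz
      rw [← NNReal.coe_le_coe]
      simp [hz, abs_of_nonneg, Real.rpow_nonneg])
  have h2 : ∑ i, ((w i : ℂ) * (starRingEnd ℂ (z i) / (‖z i‖ : ℂ) *
      ((‖z i‖₊ ^ (θ - 1) : ℝ≥0) : ℂ))) * z i = ((W : ℝ) : ℂ) := by
    rw [hW]
    push_cast
    refine Finset.sum_congr rfl fun i _ => ?_
    rcases eq_or_ne (z i) 0 with hz | hz
    · simp [hz, hθ0.ne']
    · have hn : (‖z i‖ : ℂ) ≠ 0 := by simpa using hz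
      have e1 : starRingEnd ℂ (z i) * z i = (‖z i‖ : ℂ) ^ 2 := by
        rw [mul_comm, Complex.mul_conj, Complex.normSq_eq_norm_sq]; push_cast; rfl
      have e2 : ‖z i‖ ^ θ = ‖z i‖ ^ (θ - 1) * ‖z i‖ := by
        rw [← Real.rpow_add_one (by simpa using hz)]; ring_nf
      rw [e2]
      push_cast
      field_simp
      linear_combination (w i : ℂ) * ((‖z i‖ ^ (θ - 1) : ℝ) : ℂ) * e1
  rw [h2] at h1
  have h3 : W ≤ C * W ^ (1 - 1 / θ) := by
    simpa using h1
  have h4 : W ^ (1 / θ) ≤ C := by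
    have hpos : 0 < W ^ (1 - 1 / θ) := NNReal.rpow_pos (pos_iff_ne_zero.mpr h0)
    refine le_of_mul_le_mul_right ?_ hpos
    rw [← NNReal.rpow_add h0]
    simpa using h3
  calc W = (W ^ (1 / θ)) ^ θ := by
        rw [← NNReal.rpow_mul, one_div_mul_cancel hθ0.ne', NNReal.rpow_one]
    _ ≤ C ^ θ := NNReal.rpow_le_rpow h4 hθ0.le

/-- The pointwise estimate behind the interpolation bound: a family of vectors `h` whose weighted
sums are controlled by an `ℓ^θ'`-norm has weighted sums controlled by a geometric mean. -/
theorem nnnorm_sum_smul_le {ι Y : Type*} [Fintype ι] [NormedAddCommGroup Y] [NormedSpace ℂ Y]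
    (w a : ι → ℝ≥0) (h : ι → Y) {θ q p : ℝ} (hθ : 1 ≤ θ) (hq : 1 ≤ q) (hp : 0 < p)
    (hpq : 1 / q - 1 / p = 1 - 1 / θ) (C : ℝ≥0)
    (H : ∀ (b : ι → ℂ) (κ : ι → ℝ≥0), (∀ i, ‖b i‖₊ ≤ κ i ^ (θ - 1)) →
      ‖∑ i, ((w i : ℂ) * b i) • h i‖₊ ≤ C * (∑ i, w i * κ i ^ θ) ^ (1 - 1 / θ)) :
    ‖∑ i, ((w i : ℂ) * (a i : ℂ)) • h i‖₊ ≤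
      (∑ i, w i * a i ^ q * ‖h i‖₊ ^ θ) ^ (1 / p) * (∑ i, w i * a i ^ q) ^ (1 - 1 / θ) *
        C ^ (1 - θ / p) := by
  have hθ0 : 0 < θ := by linarith
  have hq0 : 0 < q := by linarith
  have hα : 0 ≤ 1 / p := by positivity
  have hβ : 0 ≤ 1 - 1 / θ := by
    rw [sub_nonneg, div_le_one hθ0]; exact hθ
  have hq1 : 1 / q ≤ 1 := by rw [div_le_one hq0]; exact hq
  have hγ : 0 ≤ 1 / θ - 1 / p := by linarith
  obtain ⟨y, hy1, hy2⟩ := exists_dual_vector'' ℂ (∑ i, ((w i : ℂ) * (a i : ℂ)) • h i)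
  have hyle : ∀ v : Y, ‖y v‖₊ ≤ ‖v‖₊ := fun v => by
    have := y.le_of_opNorm_le hy1 v
    rw [one_mul] at this
    exact this
  have hW : ∑ i, w i * ‖y (h i)‖₊ ^ θ ≤ C ^ θ := by
    refine sum_mul_rpow_le_of_forall_norm_sum_le w (fun i => y (h i)) hθ C fun b hb => ?_
    refine le_trans ?_ (H b _ hb)
    have := hyle (∑ i, ((w i : ℂ) * b i) • h i)
    simpa only [map_sum, map_smul, smul_eq_mul] using this
  calc ‖∑ i, ((w i : ℂ) * (a i : ℂ)) • h i‖₊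
      = ‖∑ i, ((w i : ℂ) * (a i : ℂ)) * y (h i)‖₊ := by
        have e : y (∑ i, ((w i : ℂ) * (a i : ℂ)) • h i) =
            ∑ i, ((w i : ℂ) * (a i : ℂ)) * y (h i) := by
          simp only [map_sum, map_smul, smul_eq_mul]
        rw [← e, hy2]
        ext
        simp
    _ ≤ ∑ i, w i * a i * ‖y (h i)‖₊ := by
        refine (nnnorm_sum_le _ _).trans (Finset.sum_le_sum fun i _ => ?_)
        rw [nnnorm_mul, nnnorm_mul]
        simp
    -- The exponents of `w i` add up to `1`, those of `a i` to `q * (1/q)` by `hpq`, those of `‖y (h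
    -- i)‖` to `θ * (1/θ)`.
    _ = ∑ i, (w i * a i ^ q * ‖y (h i)‖₊ ^ θ) ^ (1 / p) * (w i * a i ^ q) ^ (1 - 1 / θ) *
          (w i * ‖y (h i)‖₊ ^ θ) ^ (1 / θ - 1 / p) := by
        refine Finset.sum_congr rfl fun i _ => ?_
        simp only [NNReal.mul_rpow]
        have e1 : (w i) ^ (1 / p) * (w i) ^ (1 - 1 / θ) * (w i) ^ (1 / θ - 1 / p) = w i := by
          rw [← NNReal.rpow_add_of_nonneg _ hα hβ, ← NNReal.rpow_add_of_nonneg _ (by linarith) hγ,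
            show 1 / p + (1 - 1 / θ) + (1 / θ - 1 / p) = 1 by ring, NNReal.rpow_one]
        have e2 : ((a i) ^ q) ^ (1 / p) * ((a i) ^ q) ^ (1 - 1 / θ) = a i := by
          rw [← NNReal.rpow_add_of_nonneg _ hα hβ, ← hpq, ← NNReal.rpow_mul]
          simp [hq0.ne']
        have e3 : ((‖y (h i)‖₊) ^ θ) ^ (1 / p) * ((‖y (h i)‖₊) ^ θ) ^ (1 / θ - 1 / p) =
            ‖y (h i)‖₊ := by
          rw [← NNReal.rpow_add_of_nonneg _ hα hγ, ← NNReal.rpow_mul]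
          simp [hθ0.ne']
        conv_lhs => rw [← e1, ← e2, ← e3]
        ring
    _ ≤ (∑ i, w i * a i ^ q * ‖y (h i)‖₊ ^ θ) ^ (1 / p) * (∑ i, w i * a i ^ q) ^ (1 - 1 / θ) *
          (∑ i, w i * ‖y (h i)‖₊ ^ θ) ^ (1 / θ - 1 / p) :=
        NNReal.sum_rpow_mul_rpow_mul_rpow_le _ _ _ hα hβ hγ (by ring)
    _ ≤ _ := by
        -- The third factor is controlled by `hW`; in the first, `y` is removed by `‖y (h i)‖ ≤ ‖h
        -- i‖`.
        have e : C ^ (1 - θ / p) = (C ^ θ) ^ (1 / θ - 1 / p) := by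
          rw [← NNReal.rpow_mul]
          congr 1
          field_simp
        rw [e]
        gcongr
        exact hyle _

/-! ### Norms of step functions over disjoint sets -/

section StepFunctions

variable {S X ι : Type*} [NormedAddCommGroup X] [Fintype ι]

/-- At most one summand is nonzero at each point, so `φ` need not be additive. -/
theorem apply_sum_indicator_of_disjoint {M : Type*} [AddCommMonoid M] {A : ι → Set S}
    (hd : Pairwise fun i j => Disjoint (A i) (A j)) (x : ι → X) (φ : X → M) (h0 : φ 0 = 0)
    (s : S) :
    φ (∑ i, (A i).indicator (fun _ => x i) s) = ∑ i, (A i).indicator (fun _ => φ (x i)) s := by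
  classical
  by_cases hs : ∃ i, s ∈ A i
  · obtain ⟨i, hi⟩ := hs
    have hj : ∀ j, j ≠ i → s ∉ A j := fun j hji hsj =>
      Set.disjoint_left.mp (hd hji) hsj hi
    rw [Finset.sum_eq_single i (fun j _ hji => Set.indicator_of_notMem (hj j hji) _) (by simp),
      Finset.sum_eq_single i (fun j _ hji => Set.indicator_of_notMem (hj j hji) _) (by simp)]
    simp [hi]
  · push Not at hs
    simp [hs, h0]

variable [MeasurableSpace S] {ν : Measure S}

theorem eLpNorm_sum_indicator_of_disjoint {A : ι → Set S} (hA : ∀ i, MeasurableSet (A i))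
    (hd : Pairwise fun i j => Disjoint (A i) (A j)) (x : ι → X) {r : ℝ≥0} (hr : r ≠ 0) :
    eLpNorm (∑ i, (A i).indicator fun _ => x i) r ν =
      (∑ i, ν (A i) * ‖x i‖ₑ ^ (r : ℝ)) ^ (1 / (r : ℝ)) := by
  rw [eLpNorm_nnreal_eq_lintegral hr]
  congr 1
  have h0 : (0 : ℝ) < r := by exact_mod_cast pos_iff_ne_zero.mpr hr
  have : ∀ s, ‖(∑ i, (A i).indicator fun _ => x i) s‖ₑ ^ (r : ℝ) =
      ∑ i, (A i).indicator (fun _ => ‖x i‖ₑ ^ (r : ℝ)) s := fun s => by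
    rw [Finset.sum_apply]
    exact apply_sum_indicator_of_disjoint hd x (fun v => ‖v‖ₑ ^ (r : ℝ)) (by simp [h0]) s
  simp_rw [this]
  rw [lintegral_finsetSum _ fun i _ => measurable_const.indicator (hA i)]
  refine Finset.sum_congr rfl fun i _ => ?_
  rw [lintegral_indicator_const (hA i), mul_comm]

theorem eLpNorm_top_sum_indicator_le_of_disjoint {A : ι → Set S}
    (hd : Pairwise fun i j => Disjoint (A i) (A j)) (x : ι → X) {c : ℝ≥0}
    (hx : ∀ i, ‖x i‖₊ ≤ c) :
    eLpNorm (∑ i, (A i).indicator fun _ => x i) ∞ ν ≤ c := by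
  rw [eLpNorm_exponent_top]
  refine eLpNormEssSup_le_of_ae_nnnorm_bound (Filter.Eventually.of_forall fun s => ?_)
  rw [Finset.sum_apply]
  by_cases hs : ∃ i, s ∈ A i
  · obtain ⟨i, hi⟩ := hs
    have hj : ∀ j, j ≠ i → s ∉ A j := fun j hji hsj =>
      Set.disjoint_left.mp (hd hji) hsj hi
    rw [Finset.sum_eq_single i (fun j _ hji => Set.indicator_of_notMem (hj j hji) _) (by simp)]
    simpa [hi] using hx i
  · push Not at hs
    simp [hs]

/-- For finite `θ' = r` this is `(θ - 1) * r = θ`; if `θ' = ∞` then `θ = 1` and the bound reads `1`.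
Bounding by powers of `κ` lets one formula cover both cases. -/
theorem eLpNorm_sum_indicator_le_of_disjoint {A : ι → Set S} (hA : ∀ i, MeasurableSet (A i))
    (hd : Pairwise fun i j => Disjoint (A i) (A j)) (x : ι → X) (w κ : ι → ℝ≥0)
    (hw : ∀ i, ν (A i) = w i) {θ : ℝ≥0} {θ' : ℝ≥0∞} (hθ : 1 ≤ θ)
    (hθ' : (θ : ℝ≥0∞)⁻¹ + θ'⁻¹ = 1) (hx : ∀ i, ‖x i‖₊ ≤ κ i ^ ((θ : ℝ) - 1)) :
    eLpNorm (∑ i, (A i).indicator fun _ => x i) θ' ν ≤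
      ((∑ i, w i * κ i ^ (θ : ℝ)) ^ (1 - 1 / (θ : ℝ)) : ℝ≥0) := by
  have hθ0 : θ ≠ 0 := (zero_lt_one.trans_le hθ).ne'
  have hθr : (0 : ℝ) < θ := by exact_mod_cast pos_iff_ne_zero.mpr hθ0
  induction θ' with
  | top =>
    have h1 : θ = 1 := by simpa using hθ'
    subst h1
    have := eLpNorm_top_sum_indicator_le_of_disjoint (ν := ν) hd x (c := 1) (by simpa using hx)
    simpa using this
  | coe r =>
    have hr0 : r ≠ 0 := by
      rintro rfl
      simp at hθ'
    have hr : (0 : ℝ) < r := by exact_mod_cast pos_iff_ne_zero.mpr hr0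
    have hsum : (1 : ℝ) / θ + 1 / r = 1 := by
      rw [← ENNReal.coe_inv hθ0, ← ENNReal.coe_inv hr0] at hθ'
      simpa using congrArg NNReal.toReal (by exact_mod_cast hθ' : θ⁻¹ + r⁻¹ = 1)
    have hmul : ((θ : ℝ) - 1) * r = θ := by
      field_simp at hsum
      linarith
    rw [eLpNorm_sum_indicator_of_disjoint hA hd x hr0,
      show 1 - 1 / (θ : ℝ) = 1 / (r : ℝ) by linarith,
      ENNReal.coe_rpow_of_nonneg _ (by positivity)]
    refine ENNReal.rpow_le_rpow ?_ (by positivity)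
    rw [ENNReal.ofNNReal_finsetSum]
    refine Finset.sum_le_sum fun i _ => ?_
    rw [hw i, ENNReal.coe_mul, enorm_eq_nnnorm, ← ENNReal.coe_rpow_of_nonneg _ hr.le]
    gcongr
    calc ‖x i‖₊ ^ (r : ℝ) ≤ (κ i ^ ((θ : ℝ) - 1)) ^ (r : ℝ) := NNReal.rpow_le_rpow (hx i) hr.le
      _ = κ i ^ (θ : ℝ) := by rw [← NNReal.rpow_mul, hmul]

end StepFunctions

/-! ### Disjoint representations and density in `L_r` -/

section FinSimple

variable {S X : Type*} [MeasurableSpace S] {ν : Measure S} [NormedAddCommGroup X] [NormedSpace ℂ X]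

theorem indicator_const_mem_finSimple {A : Set S} (hA : MeasurableSet A) (hν : ν A < ∞) (x : X) :
    (A.indicator fun _ => x) ∈ finSimple ν X :=
  ⟨1, fun _ => x, fun _ => A, fun _ => ⟨hA, hν⟩, by simp⟩

theorem finSimple_exists_simpleFunc (f : finSimple ν X) : ∃ g : SimpleFunc S X, ⇑g = (f : S → X) := by
  classical
  obtain ⟨f, n, x, A, hA, rfl⟩ := f
  change ∃ g : SimpleFunc S X, ⇑g = ∑ i, (A i).indicator fun _ => x i
  refine Finset.sum_induction _ (fun f : S → X => ∃ g : SimpleFunc S X, ⇑g = f) ?_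
    ⟨0, SimpleFunc.coe_zero⟩ fun i _ => ?_
  · rintro _ _ ⟨g, rfl⟩ ⟨h, rfl⟩
    exact ⟨g + h, SimpleFunc.coe_add g h⟩
  · refine ⟨SimpleFunc.piecewise (A i) (hA i).1 (SimpleFunc.const S (x i)) 0, ?_⟩
    rw [SimpleFunc.coe_piecewise, SimpleFunc.coe_zero, Set.piecewise_eq_indicator]
    rfl

/-- Every element of `ε(S, X)` is a sum over disjoint sets with nonzero values. -/
theorem finSimple_exists_disjoint (f : finSimple ν X) :
    ∃ (I : Finset X) (A : I → Set S), (∀ i : I, (i : X) ≠ 0) ∧ (∀ i, MeasurableSet (A i)) ∧ (∀ i, ν (A i) < ∞) ∧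
      (Pairwise fun i j => Disjoint (A i) (A j)) ∧
      (f : S → X) = ∑ i, (A i).indicator fun _ => (i : X) := by
  classical
  obtain ⟨g, hg⟩ := finSimple_exists_simpleFunc f
  have hmem : MemLp g 1 ν := hg ▸ finSimple_memLp f 1
  refine ⟨g.range.filter (· ≠ 0), fun i => g ⁻¹' {(i : X)},
    fun i => (Finset.mem_filter.mp i.2).2, fun i => g.measurableSet_fiber _,
    fun i => g.measure_preimage_lt_top_of_memLp one_ne_zero ENNReal.one_ne_top hmem _
      (Finset.mem_filter.mp i.2).2, fun i j hij => ?_, ?_⟩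
  · exact Disjoint.preimage _ (Set.disjoint_singleton.mpr fun h => hij (Subtype.ext h))
  · rw [← hg]
    ext s
    rw [Finset.sum_apply]
    by_cases hs : g s = 0
    · rw [hs, Finset.sum_eq_zero]
      intro i _
      refine Set.indicator_of_notMem (fun h => ?_) _
      exact (Finset.mem_filter.mp i.2).2 (by rw [← Set.mem_singleton_iff.mp h]; exact hs)
    · rw [Finset.sum_eq_single ⟨g s, Finset.mem_filter.mpr ⟨g.mem_range_self s, hs⟩⟩]
      · simp
      · intro j _ hj
        refine Set.indicator_of_notMem (fun h => hj ?_) _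
        exact Subtype.ext (Set.mem_singleton_iff.mp h).symm
      · simp

/-- The class map from `ε(S, X)` to `L_r(S, X)`. -/
noncomputable def finSimpleToLp (ν : Measure S) (X : Type*) [NormedAddCommGroup X]
    [NormedSpace ℂ X] (r : ℝ≥0∞) : finSimple ν X →ₗ[ℂ] Lp X r ν where
  toFun f := (finSimple_memLp f r).toLp f
  map_add' _ _ := rfl
  map_smul' _ _ := rfl

theorem denseRange_finSimpleToLp (r : ℝ≥0∞) [Fact (1 ≤ r)] (hr : r ≠ ∞) :
    DenseRange (finSimpleToLp ν X r) := by
  intro f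
  change f ∈ closure (Set.range _)
  rw [← LinearMap.coe_range, ← Submodule.topologicalClosure_coe, SetLike.mem_coe]
  refine Lp.induction hr (fun f => f ∈ (LinearMap.range (finSimpleToLp ν X r)).topologicalClosure)
    (fun c s hs hμs => ?_) (fun f g hf hg _ h₁ h₂ => Submodule.add_mem _ h₁ h₂)
    (Submodule.isClosed_topologicalClosure _) f
  refine Submodule.le_topologicalClosure _ ⟨⟨_, indicator_const_mem_finSimple hs hμs c⟩, ?_⟩
  rw [Lp.simpleFunc.coe_indicatorConst]
  rfl

end FinSimple

/-! ### One null set for all linear combinations -/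

theorem MeasureTheory.AEEqFun.coeFn_finset_sum_smul {T Y ι : Type*} [MeasurableSpace T]
    {μ : Measure T} [NormedAddCommGroup Y] [NormedSpace ℂ Y] (s : Finset ι) (b : ι → ℂ)
    (F : ι → T →ₘ[μ] Y) :
    ⇑(∑ i ∈ s, b i • F i) =ᵐ[μ] fun t => ∑ i ∈ s, b i • F i t := by
  classical
  induction s using Finset.induction_on with
  | empty =>
    simp only [Finset.sum_empty]
    exact AEEqFun.coeFn_zero
  | insert i s hi ih =>
    rw [Finset.sum_insert hi]
    filter_upwards [AEEqFun.coeFn_add (b i • F i) (∑ j ∈ s, b j • F j),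
      AEEqFun.coeFn_smul (b i) (F i), ih] with t h₁ h₂ h₃
    rw [h₁, Pi.add_apply, h₂, h₃, Finset.sum_insert hi, Pi.smul_apply]

/-- If `K` is bounded into `L_∞`, then almost everywhere the bound holds simultaneously for all
linear combinations of finitely many given functions. -/
theorem ae_forall_norm_sum_smul_le {S T X Y ι : Type*} [MeasurableSpace S] [MeasurableSpace T]
    {ν : Measure S} {μ : Measure T} [NormedAddCommGroup X] [NormedSpace ℂ X]
    [NormedAddCommGroup Y] [NormedSpace ℂ Y] [Fintype ι] {r : ℝ≥0∞} [Fact (1 ≤ r)] (C : ℝ≥0)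
    (K : finSimple ν X →ₗ[ℂ] (T →ₘ[μ] Y))
    (hK : ∀ f : finSimple ν X, eLpNorm (K f) ∞ μ ≤ C * eLpNorm (f : S → X) r ν)
    (e : ι → finSimple ν X) :
    ∀ᵐ t ∂μ, ∀ b : ι → ℂ,
      ‖∑ i, b i • K (e i) t‖ ≤ C * ‖finSimpleToLp ν X r (∑ i, b i • e i)‖ := by
  -- Countably many null sets can be discarded; both sides are continuous in `b`, so the bound
  -- passes from `D` to every `b`.
  obtain ⟨D, hDc, hDd⟩ := TopologicalSpace.exists_countable_dense (ι → ℂ)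
  have hD : ∀ᵐ t ∂μ, ∀ b ∈ D,
      ‖∑ i, b i • K (e i) t‖ ≤ C * ‖finSimpleToLp ν X r (∑ i, b i • e i)‖ := by
    refine (ae_ball_iff hDc).mpr fun b _ => ?_
    have h := hK (∑ i, b i • e i)
    rw [eLpNorm_exponent_top] at h
    have hs : K (∑ i, b i • e i) = ∑ i, b i • K (e i) := by simp only [map_sum, map_smul]
    filter_upwards [enorm_ae_le_eLpNormEssSup (K (∑ i, b i • e i)) μ,
      AEEqFun.coeFn_finset_sum_smul Finset.univ b fun i => K (e i)] with t h₁ h₂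
    have h₃ := h₁.trans h
    rw [hs, h₂, ← Lp.enorm_toLp (finSimple_memLp (∑ i, b i • e i) r), enorm_eq_nnnorm,
      enorm_eq_nnnorm, ← ENNReal.coe_mul, ENNReal.coe_le_coe, ← NNReal.coe_le_coe] at h₃
    exact h₃
  let Φ : (ι → ℂ) →ₗ[ℂ] Lp X r ν :=
    ∑ i, (LinearMap.proj i : (ι → ℂ) →ₗ[ℂ] ℂ).smulRight (finSimpleToLp ν X r (e i))
  have hΦ : ∀ b, finSimpleToLp ν X r (∑ i, b i • e i) = Φ b := fun b => by
    simp [Φ, map_sum, map_smul]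
  filter_upwards [hD] with t ht b
  refine hDd.induction (P := fun b : ι → ℂ =>
    ‖∑ i, b i • K (e i) t‖ ≤ C * ‖finSimpleToLp ν X r (∑ i, b i • e i)‖) (fun b hb => ht b hb) ?_ b
  simp_rw [hΦ]
  have := Φ.continuous_of_finiteDimensional
  exact isClosed_le (by fun_prop) (by fun_prop)

/-! ### The interpolation bound on step functions -/

section Bound

variable {S T X Y : Type*} [MeasurableSpace S] [MeasurableSpace T]
  {ν : Measure S} {μ : Measure T} [NormedAddCommGroup X] [NormedSpace ℂ X]
  [NormedAddCommGroup Y] [NormedSpace ℂ Y] {θ q p : ℝ≥0} {θ' : ℝ≥0∞}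

theorem eLpNorm_map_sum_smul_le {ι : Type*} [Fintype ι] (hq : 1 ≤ q) (hp : 1 ≤ p)
    (hθ : 1 ≤ θ) (hθ' : (θ : ℝ≥0∞)⁻¹ + θ'⁻¹ = 1)
    (hpq : 1 / (q : ℝ) - 1 / (p : ℝ) = 1 - 1 / (θ : ℝ)) (C₁ C₂ : ℝ≥0)
    (K : finSimple ν X →ₗ[ℂ] (T →ₘ[μ] Y))
    (hK₁ : ∀ f : finSimple ν X, eLpNorm (K f) θ μ ≤ C₁ * eLpNorm (f : S → X) 1 ν)
    (hK₂ : ∀ f : finSimple ν X, eLpNorm (K f) ∞ μ ≤ C₂ * eLpNorm (f : S → X) θ' ν)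
    {A : ι → Set S} (hA : ∀ i, MeasurableSet (A i))
    (hd : Pairwise fun i j => Disjoint (A i) (A j)) (w : ι → ℝ≥0) (hw : ∀ i, ν (A i) = w i)
    (u : ι → X) (hu : ∀ i, ‖u i‖₊ = 1) (e : ι → finSimple ν X)
    (he : ∀ i, (e i : S → X) = (A i).indicator fun _ => u i) (a : ι → ℝ≥0) :
    eLpNorm (K (∑ i, (a i : ℂ) • e i)) p μ ≤
      (C₁ ^ ((θ : ℝ) / p) * C₂ ^ (1 - (θ : ℝ) / p) : ℝ≥0) *
        eLpNorm ((∑ i, (a i : ℂ) • e i : finSimple ν X) : S → X) q ν := by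
  have hθ0 : θ ≠ 0 := (zero_lt_one.trans_le hθ).ne'
  have hq0 : q ≠ 0 := (zero_lt_one.trans_le hq).ne'
  have hp0 : p ≠ 0 := (zero_lt_one.trans_le hp).ne'
  have hθr : (0 : ℝ) < θ := by exact_mod_cast pos_iff_ne_zero.mpr hθ0
  have hqr : (0 : ℝ) < q := by exact_mod_cast pos_iff_ne_zero.mpr hq0
  have hpr : (0 : ℝ) < p := by exact_mod_cast pos_iff_ne_zero.mpr hp0
  have hβ : 0 ≤ 1 - 1 / (θ : ℝ) := by
    rw [sub_nonneg, div_le_one hθr]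
    exact_mod_cast hθ
  have : Fact (1 ≤ θ') := ⟨by
    rw [← ENNReal.inv_le_inv, inv_one, ← hθ']
    exact le_add_self⟩
  have hcoe : ∀ b : ι → ℂ, ((∑ i, b i • e i : finSimple ν X) : S → X) =
      ∑ i, (A i).indicator fun _ => b i • u i := fun b => by
    rw [AddSubmonoidClass.coe_finsetSum]
    refine Finset.sum_congr rfl fun i _ => ?_
    rw [Submodule.coe_smul, he]
    ext s
    exact (Set.indicator_const_smul_apply (A i) (b i) (fun _ => u i) s).symm
  have hH : ∀ i, eLpNorm (K (e i)) θ μ ≤ C₁ * w i := fun i => by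
    refine (hK₁ (e i)).trans_eq ?_
    rw [he, eLpNorm_indicator_const (hA i) one_ne_zero ENNReal.one_ne_top, hw, enorm_eq_nnnorm, hu]
    simp
  -- If `w i = 0` then `h i = 0`; nothing is lost, since `hH` then forces `K (e i) = 0` almost
  -- everywhere.
  let h : ι → T → Y := fun i t => ((w i : ℂ)⁻¹) • K (e i) t
  have hmeas : ∀ i, AEStronglyMeasurable (h i) μ := fun i =>
    (K (e i)).aestronglyMeasurable.const_smul _
  have hh : ∀ i, ∫⁻ t, ‖h i t‖ₑ ^ (θ : ℝ) ∂μ ≤ (C₁ ^ (θ : ℝ) : ℝ≥0) := fun i => by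
    have h1 : eLpNorm (h i) θ μ ≤ C₁ := by
      change eLpNorm ((w i : ℂ)⁻¹ • ⇑(K (e i))) θ μ ≤ C₁
      rw [eLpNorm_const_smul]
      refine (mul_le_mul_right (hH i) _).trans ?_
      rw [enorm_eq_nnnorm, ← ENNReal.coe_mul, ← ENNReal.coe_mul, ENNReal.coe_le_coe]
      rcases eq_or_ne (w i) 0 with h0 | h0
      · simp [h0]
      · simp only [nnnorm_inv, Complex.nnnorm_real, NNReal.nnnorm_eq]
        field_simp
        exact le_rfl
    rw [eLpNorm_nnreal_eq_lintegral hθ0] at h1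
    rw [ENNReal.coe_rpow_of_nonneg _ hθr.le]
    refine le_trans (le_of_eq ?_) (ENNReal.rpow_le_rpow h1 hθr.le)
    rw [← ENNReal.rpow_mul, one_div_mul_cancel hθr.ne', ENNReal.rpow_one]
  have hwh : ∀ᵐ t ∂μ, ∀ i, (w i : ℂ) • h i t = K (e i) t := by
    refine ae_all_iff.mpr fun i => ?_
    rcases eq_or_ne (w i) 0 with h0 | h0
    · have h1 := hH i
      rw [h0, ENNReal.coe_zero, mul_zero, nonpos_iff_eq_zero,
        eLpNorm_eq_zero_iff (K (e i)).aestronglyMeasurable (by simpa using hθ0)] at h1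
      filter_upwards [h1] with t ht
      simp [h0, ht]
    · refine Filter.Eventually.of_forall fun t => ?_
      exact smul_inv_smul₀ (by simpa using h0) _
  -- `N` is the `q`-th power of the `L_q` norm of the step function; `B` collects the factors of the
  -- pointwise bound independent of `t`.
  set N : ℝ≥0 := ∑ i, w i * a i ^ (q : ℝ) with hN
  set B : ℝ≥0 := N ^ (1 - 1 / (θ : ℝ)) * C₂ ^ (1 - (θ : ℝ) / p) with hB
  have hpt : ∀ᵐ t ∂μ, ‖K (∑ i, (a i : ℂ) • e i) t‖ₑ ^ (p : ℝ) ≤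
      (∑ i, (w i * a i ^ (q : ℝ) : ℝ≥0) * ‖h i t‖ₑ ^ (θ : ℝ)) * (B ^ (p : ℝ) : ℝ≥0) := by
    have hs : K (∑ i, (a i : ℂ) • e i) = ∑ i, (a i : ℂ) • K (e i) := by
      simp only [map_sum, map_smul]
    filter_upwards [ae_forall_norm_sum_smul_le C₂ K hK₂ e, hwh,
      AEEqFun.coeFn_finset_sum_smul Finset.univ (fun i => (a i : ℂ)) fun i => K (e i)]
      with t h₁ h₂ h₃
    have hsum : ∀ b : ι → ℂ, ∑ i, ((w i : ℂ) * b i) • h i t = ∑ i, b i • K (e i) t := fun b => by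
      refine Finset.sum_congr rfl fun i _ => ?_
      rw [mul_comm, mul_smul, h₂]
    have key := nnnorm_sum_smul_le w a (fun i => h i t) (θ := θ) (q := q) (p := p)
      (by exact_mod_cast hθ) (by exact_mod_cast hq) hpr hpq C₂ (fun b κ hb => by
        rw [hsum]
        refine (show ‖∑ i, b i • K (e i) t‖₊ ≤
          C₂ * ‖finSimpleToLp ν X θ' (∑ i, b i • e i)‖₊ from h₁ b).trans ?_
        gcongr
        rw [← ENNReal.coe_le_coe, ← enorm_eq_nnnorm]
        refine (Lp.enorm_toLp (finSimple_memLp (∑ i, b i • e i) θ')).trans_le ?_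
        rw [hcoe]
        refine eLpNorm_sum_indicator_le_of_disjoint hA hd _ w κ hw hθ hθ' fun i => ?_
        rw [nnnorm_smul, hu, mul_one]
        exact hb i)
    rw [hsum, mul_assoc, ← hB] at key
    rw [hs, h₃, enorm_eq_nnnorm]
    simp_rw [enorm_eq_nnnorm, ← ENNReal.coe_rpow_of_nonneg _ hθr.le, ← ENNReal.coe_mul,
      ← ENNReal.ofNNReal_finsetSum]
    rw [← ENNReal.coe_rpow_of_nonneg _ hpr.le, ← ENNReal.coe_mul, ENNReal.coe_le_coe]
    refine (NNReal.rpow_le_rpow key hpr.le).trans_eq ?_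
    rw [NNReal.mul_rpow, ← NNReal.rpow_mul, one_div_mul_cancel hpr.ne', NNReal.rpow_one]
  have hint : ∫⁻ t, ‖K (∑ i, (a i : ℂ) • e i) t‖ₑ ^ (p : ℝ) ∂μ ≤
      (N * C₁ ^ (θ : ℝ) * B ^ (p : ℝ) : ℝ≥0) := by
    refine (lintegral_mono_ae hpt).trans ?_
    rw [lintegral_mul_const' _ _ ENNReal.coe_ne_top, ENNReal.coe_mul]
    refine mul_le_mul_left ?_ _
    rw [lintegral_finsetSum' _ fun i _ => ((hmeas i).enorm.pow_const _).const_mul _, hN,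
      Finset.sum_mul, ENNReal.ofNNReal_finsetSum]
    refine Finset.sum_le_sum fun i _ => ?_
    rw [lintegral_const_mul' _ _ ENNReal.coe_ne_top, ENNReal.coe_mul]
    exact mul_le_mul_right (hh i) _
  have hnorm : eLpNorm ((∑ i, (a i : ℂ) • e i : finSimple ν X) : S → X) q ν =
      (N ^ (1 / (q : ℝ)) : ℝ≥0) := by
    rw [hcoe, eLpNorm_sum_indicator_of_disjoint hA hd _ hq0,
      ENNReal.coe_rpow_of_nonneg _ (by positivity), hN, ENNReal.ofNNReal_finsetSum]
    congr 1
    refine Finset.sum_congr rfl fun i _ => ?_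
    rw [hw, enorm_eq_nnnorm, nnnorm_smul, hu, mul_one, ENNReal.coe_mul,
      ENNReal.coe_rpow_of_nonneg _ hqr.le]
    simp
  rw [hnorm, eLpNorm_nnreal_eq_lintegral hp0, ← ENNReal.coe_mul]
  refine (ENNReal.rpow_le_rpow hint (by positivity)).trans_eq ?_
  rw [← ENNReal.coe_rpow_of_nonneg _ (by positivity)]
  congr 1
  -- One power of `N` comes from the integral and the other from `B`; by `hpq` they recombine to the
  -- `L_q` norm.
  have hNq : N ^ (1 / (q : ℝ)) = N ^ (1 / (p : ℝ)) * N ^ (1 - 1 / (θ : ℝ)) := by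
    rw [← NNReal.rpow_add_of_nonneg _ (by positivity) hβ, ← hpq]
    ring_nf
  rw [NNReal.mul_rpow, NNReal.mul_rpow, ← NNReal.rpow_mul, ← NNReal.rpow_mul,
    mul_one_div_cancel hpr.ne', NNReal.rpow_one, mul_one_div, hNq, hB]
  ring

theorem eLpNorm_map_finSimple_le (hq : 1 ≤ q) (hp : 1 ≤ p)
    (hθ : 1 ≤ θ) (hθ' : (θ : ℝ≥0∞)⁻¹ + θ'⁻¹ = 1)
    (hpq : 1 / (q : ℝ) - 1 / (p : ℝ) = 1 - 1 / (θ : ℝ)) (C₁ C₂ : ℝ≥0)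
    (K : finSimple ν X →ₗ[ℂ] (T →ₘ[μ] Y))
    (hK₁ : ∀ f : finSimple ν X, eLpNorm (K f) θ μ ≤ C₁ * eLpNorm (f : S → X) 1 ν)
    (hK₂ : ∀ f : finSimple ν X, eLpNorm (K f) ∞ μ ≤ C₂ * eLpNorm (f : S → X) θ' ν)
    (f : finSimple ν X) :
    eLpNorm (K f) p μ ≤
      (C₁ ^ ((θ : ℝ) / p) * C₂ ^ (1 - (θ : ℝ) / p) : ℝ≥0) * eLpNorm (f : S → X) q ν := by
  obtain ⟨I, A, hx, hA, hν, hd, hf⟩ := finSimple_exists_disjoint f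
  let x : I → X := fun i => i
  -- Polar decomposition of the values, possible because the representation omits the value zero.
  let u : I → X := fun i => (‖x i‖ : ℂ)⁻¹ • x i
  let e : I → finSimple ν X := fun i => ⟨_, indicator_const_mem_finSimple (hA i) (hν i) (u i)⟩
  have hfe : f = ∑ i, (‖x i‖₊ : ℂ) • e i := by
    refine Subtype.ext ?_
    rw [hf, AddSubmonoidClass.coe_finsetSum]
    refine Finset.sum_congr rfl fun i _ => ?_
    rw [Submodule.coe_smul]
    ext s
    refine Eq.trans ?_ (Set.indicator_const_smul_apply (A i) (‖x i‖₊ : ℂ) (fun _ => u i) s)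
    congr 1
    funext _
    exact (smul_inv_smul₀ (by simpa [x] using hx i) _).symm
  rw [hfe]
  refine eLpNorm_map_sum_smul_le hq hp hθ hθ' hpq C₁ C₂ K hK₁ hK₂ hA hd
    (fun i => (ν (A i)).toNNReal) (fun i => (ENNReal.coe_toNNReal (hν i).ne).symm) u (fun i => ?_)
    e (fun i => rfl) fun i => ‖x i‖₊
  ext
  have : ‖x i‖ ≠ 0 := by simpa [x] using hx i
  simp [u, norm_smul, this]

end Bound

/-! ### Extension to `L_q` by density -/

theorem lemma2p6 {S T X Y : Type*} [MeasurableSpace S] [MeasurableSpace T]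
    (ν : Measure S) (μ : Measure T)
    [NormedAddCommGroup X] [NormedSpace ℂ X] [CompleteSpace X]
    [NormedAddCommGroup Y] [NormedSpace ℂ Y] [CompleteSpace Y]
    (θ q p : ℝ≥0) (θ' : ℝ≥0∞)
    [Fact (1 ≤ (q : ℝ≥0∞))] [Fact (1 ≤ (p : ℝ≥0∞))]
    (hθ : 1 ≤ θ) (hθ' : (θ : ℝ≥0∞)⁻¹ + θ'⁻¹ = 1)
    (hq : (q : ℝ≥0∞) < θ')
    (hpq : 1 / (q : ℝ) - 1 / (p : ℝ) = 1 - 1 / (θ : ℝ))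
    (C₁ C₂ : ℝ≥0)
    (K : finSimple ν X →ₗ[ℂ] LpAddLinfty μ Y θ)
    (hK₁ : ∀ f : finSimple ν X,
      eLpNorm (K f : T →ₘ[μ] Y) θ μ ≤ C₁ * eLpNorm (f : S → X) 1 ν)
    (hK₂ : ∀ f : finSimple ν X,
      eLpNorm (K f : T →ₘ[μ] Y) ∞ μ ≤ C₂ * eLpNorm (f : S → X) θ' ν) :
    ∃ L : Lp X (q : ℝ≥0∞) ν →L[ℂ] Lp Y (p : ℝ≥0∞) μ,
      (∀ f : finSimple ν X,
        (L ((finSimple_memLp f (q : ℝ≥0∞)).toLp (f : S → X)) : T →ₘ[μ] Y)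
          = (K f : T →ₘ[μ] Y)) ∧
      ‖L‖ ≤ (C₁ : ℝ) ^ ((θ : ℝ) / (p : ℝ)) * (C₂ : ℝ) ^ (1 - (θ : ℝ) / (p : ℝ)) := by
  have hq1 : 1 ≤ q := by exact_mod_cast (Fact.out : 1 ≤ (q : ℝ≥0∞))
  have hp1 : 1 ≤ p := by exact_mod_cast (Fact.out : 1 ≤ (p : ℝ≥0∞))
  set C : ℝ≥0 := C₁ ^ ((θ : ℝ) / p) * C₂ ^ (1 - (θ : ℝ) / p) with hC
  have hbound := eLpNorm_map_finSimple_le hq1 hp1 hθ hθ' hpq C₁ C₂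
    ((LpAddLinfty μ Y θ).subtype ∘ₗ K) hK₁ hK₂
  have hmem : ∀ f : finSimple ν X, (K f : T →ₘ[μ] Y) ∈ Lp Y (p : ℝ≥0∞) μ :=
    fun f => Lp.mem_Lp_iff_eLpNorm_lt_top.mpr <| (hbound f).trans_lt <|
      ENNReal.mul_lt_top ENNReal.coe_lt_top (finSimple_memLp f q).eLpNorm_lt_top
  let K' : finSimple ν X →ₗ[ℂ] Lp Y (p : ℝ≥0∞) μ :=
    { toFun := fun f => ⟨K f, hmem f⟩
      map_add' := fun f g => Subtype.ext (congrArg (LpAddLinfty μ Y θ).subtype (K.map_add f g))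
      map_smul' := fun c f => Subtype.ext (congrArg (LpAddLinfty μ Y θ).subtype (K.map_smul c f)) }
  have hdense := denseRange_finSimpleToLp (ν := ν) (X := X) (q : ℝ≥0∞) ENNReal.coe_ne_top
  have hnorm : ∀ f, ‖K' f‖ ≤ (C : ℝ) * ‖finSimpleToLp ν X (q : ℝ≥0∞) f‖ := fun f => by
    have h := hbound f
    rw [← Lp.enorm_toLp (finSimple_memLp f q), enorm_eq_nnnorm, ← ENNReal.coe_mul] at h
    have h' : ‖K' f‖ₑ ≤ _ := (Lp.enorm_def (K' f)).trans_le h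
    rw [enorm_eq_nnnorm, ENNReal.coe_le_coe] at h'
    exact h'
  refine ⟨K'.extendOfNorm (finSimpleToLp ν X (q : ℝ≥0∞)), fun f => ?_, ?_⟩
  · exact congrArg Subtype.val (LinearMap.extendOfNorm_eq hdense ⟨_, hnorm⟩ f)
  · have := LinearMap.opNorm_extendOfNorm_le hdense C.2 hnorm
    simpa [hC] using this
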